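/- Let $A$ be a unital $C^*$-algebra, $\alpha$ an endomorphism of $A$ (a $*$-homomorphism $A\to A$, not assumed unital or injective), and $L$ a transfer operator for $(A,\alpha)$: a continuous linear map $L:A\to A$ with $L(a)\ge 0$ for $a\ge 0$ and $L(\alpha(a)b)=aL(b)$ for all $a,b\in A$. A *Toeplitz-covariant representation* of $(A,\alpha,L)$ in a unital $C^*$-algebra $B$ is a pair $(\rho,V)$ of a unital $*$-homomorphism $\rho:A\to B$ and an element $V\in B$ with $V\rho(a)=\rho(\alpha(a))V$ and $V^*\rho(a)V=\rho(L(a))$ for all $a\in A$. Exel's Toeplitz algebra $\mathcal T(A,\alpha,L)$ is the universal unital $C^*$-algebra for such pairs; $(i_A,S)$ denotes the universal pair. Let $M_L$ be the right Hilbert $A$-module obtained by completing the quotient of $A$ by $N=\{a: L(a^*a)=0\}$, with quotient map $q:A\to A/N\subset M_L$, inner product $\langle q(a),q(b)\rangle=L(a^*b)$ and right action $q(m)\cdot a=q(m\alpha(a))$; it is a Hilbert bimodule over $A$ with left action $a\cdot q(m)=q(am)$. A *Toeplitz representation* of a Hilbert bimodule $X$ over $A$ in a $C^*$-algebra $B$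 is a pair $(\psi,\pi)$ of a linear map $\psi:X\to B$ and a (not necessarily unital) $*$-homomorphism $\pi:A\to B$ with $\psi(x\cdot a)=\psi(x)\pi(a)$, $\psi(x)^*\psi(y)=\pi(\langle x,y\rangle)$ and $\psi(a\cdot x)=\pi(a)\psi(x)$. The Toeplitz algebra $\mathcal T(X)$ is the universal $C^*$-algebra for such pairs; $(k_X,k_A)$ denotes the universal one. 1. For every unital $C^*$-algebra $B$, the Toeplitz-covariant representations of $(A,\alpha,L)$ in $B$ and the Toeplitz representations $(\psi,\pi)$ of $M_L$ in $B$ with $\pi$ unital are in one-to-one correspondence. For each $(\rho,V)$ there is exactly one Toeplitz representation $(\psi,\pi)$ with $\pi=\rho$ and $\psi(q(a))=\rho(a)V$ for all $a\in A$. Conversely, for each $(\psi,\pi)$ with $\pi$ unital there is exactly one Toeplitz-covariant representation $(\rho,V)$ with $\rho=\pi$, $V=\psi(q(1))$ and $\psi(q(a))=\rho(a)V$ for all $a\in A$. 2. There is a $*$-isomorphism $\theta:\mathcal T(A,\alpha,L)\to\mathcal T(M_L)$ such that $\theta(i_A(a))=k_A(a)$ and $\theta(i_A(a)S)=k_{M_L}(q(a))$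 for all $a\in A$. -/

import Mathlib

open scoped ENNReal InnerProductSpace

universe u v w

noncomputable section

/-! ### Hilbert bimodules and their Toeplitz representations -/

/-- A Hilbert bimodule over a C*-algebra `A`: a right Hilbert `A`-module `X` (complete for the norm
`‖x‖ = ‖⟨x, x⟩‖^{1/2}`, with `A`-valued inner product linear in the second variable), together with
a *-homomorphism `φ = left` of `A` into the adjointable operators on `X`. No nondegeneracy of `φ`
and no fullness of the inner product is required. -/
class HilbertBimodule (A : Type u) (X : Type v) [NonUnitalCStarAlgebra A] [PartialOrder A]
    [NormedAddCommGroup X] [NormedSpace ℂ X] where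
  /-- the `A`-valued inner product -/
  ip : X → X → A
  /-- the right action: `right x a` is `x · a` -/
  right : X → A → X
  /-- the left action: `left a x` is `a · x = φ(a) x` -/
  left : A → X → X
  complete : CompleteSpace X
  right_add (x : X) (a b : A) : right x (a + b) = right x a + right x b
  add_right (x y : X) (a : A) : right (x + y) a = right x a + right y a
  right_smul (c : ℂ) (x : X) (a : A) : right x (c • a) = c • right x a
  smul_right (c : ℂ) (x : X) (a : A) : right (c • x) a = c • right x a
  right_mul (x : X) (a b : A) : right x (a * b) = right (right x a) b
  ip_add (x y z : X) : ip x (y + z) = ip x y + ip x z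
  ip_smul (c : ℂ) (x y : X) : ip x (c • y) = c • ip x y
  ip_right (x y : X) (a : A) : ip x (right y a) = ip x y * a
  star_ip (x y : X) : star (ip x y) = ip y x
  ip_self_nonneg (x : X) : 0 ≤ ip x x
  norm_eq (x : X) : ‖x‖ = √‖ip x x‖
  left_add (a : A) (x y : X) : left a (x + y) = left a x + left a y
  left_smul (c : ℂ) (a : A) (x : X) : left a (c • x) = c • left a x
  add_left (a b : A) (x : X) : left (a + b) x = left a x + left b x
  smul_left (c : ℂ) (a : A) (x : X) : left (c • a) x = c • left a x
  mul_left (a b : A) (x : X) : left (a * b) x = left a (left b x)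
  /-- `φ(a)` is adjointable, with adjoint `φ(a*)` -/
  ip_left (a : A) (x y : X) : ip (left a x) y = ip x (left (star a) y)

/-- A Toeplitz representation `(ψ, π)` of the Hilbert bimodule `X` over `A` in a C*-algebra `B`. -/
structure ToeplitzRep (A : Type u) (X : Type v) [NonUnitalCStarAlgebra A] [PartialOrder A]
    [NormedAddCommGroup X] [NormedSpace ℂ X] [HilbertBimodule A X]
    (B : Type w) [NonUnitalCStarAlgebra B] where
  psi : X →ₗ[ℂ] B
  pi : A →⋆ₙₐ[ℂ] B
  psi_right (x : X) (a : A) : psi (HilbertBimodule.right x a) = psi x * pi a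
  star_psi_mul (x y : X) : star (psi x) * psi y = pi (HilbertBimodule.ip x y)
  psi_left (a : A) (x : X) : psi (HilbertBimodule.left a x) = pi a * psi x

theorem ToeplitzRep.norm_psi_le {A : Type u} {X : Type v} [NonUnitalCStarAlgebra A]
    [PartialOrder A] [NormedAddCommGroup X] [NormedSpace ℂ X] [HilbertBimodule A X]
    {B : Type w} [NonUnitalCStarAlgebra B] (R : ToeplitzRep A X B) (x : X) :
    ‖R.psi x‖ ≤ ‖x‖ := by
  rw [HilbertBimodule.norm_eq (A := A) x]
  apply Real.le_sqrt_of_sq_le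
  rw [sq, ← CStarRing.norm_star_mul_self, R.star_psi_mul]
  exact NonUnitalStarAlgHom.norm_apply_le R.pi _

/-- A C*-algebra (in the universe of `A` and `X`) together with a Toeplitz representation of `X`
in it. -/
structure ToeplitzRepInto (A : Type u) (X : Type v) [NonUnitalCStarAlgebra A] [PartialOrder A]
    [NormedAddCommGroup X] [NormedSpace ℂ X] [HilbertBimodule A X] where
  B : Type (max u v)
  [alg : NonUnitalCStarAlgebra B]
  rep : ToeplitzRep A X B

attribute [instance] ToeplitzRepInto.alg

section ToeplitzAlgebra

variable (A : Type u) (X : Type v) [NonUnitalCStarAlgebra A] [PartialOrder A]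
  [NormedAddCommGroup X] [NormedSpace ℂ X] [HilbertBimodule A X]

/-- The direct product (bounded families, supremum norm) of the target algebras of all Toeplitz
representations of `X`. -/
abbrev ToeplitzProduct : Type (max (u + 1) (v + 1)) :=
  lp (fun i : ToeplitzRepInto A X => i.B) ∞

/-- The family `(π(a))` indexed by all Toeplitz representations `(ψ, π)`. -/
def toeplitzProductA (a : A) : ToeplitzProduct A X :=
  ⟨fun i => i.rep.pi a, memℓp_infty ⟨‖a‖, by
    rintro _ ⟨i, rfl⟩
    exact NonUnitalStarAlgHom.norm_apply_le i.rep.pi a⟩⟩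

/-- The family `(ψ(x))` indexed by all Toeplitz representations `(ψ, π)`. -/
def toeplitzProductX (x : X) : ToeplitzProduct A X :=
  ⟨fun i => i.rep.psi x, memℓp_infty ⟨‖x‖, by
    rintro _ ⟨i, rfl⟩
    exact i.rep.norm_psi_le x⟩⟩

/-- The Toeplitz algebra `𝒯(X)`: the universal C*-algebra for Toeplitz representations of `X`, as
the C*-subalgebra generated by the product of all Toeplitz representations of `X`. Thus the norm of
a *-polynomial in the generators is the supremum of its norms over all Toeplitz representations.
(The C*-algebra generated by the image of a Toeplitz representation has at most
`max(#A, #X, 2)^ℵ₀` elements, so an isomorphic copy of it lies in `Type (max u v)`: restricting to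
targets in that universe loses no representation.) -/
def toeplitzSubalgebra : NonUnitalStarSubalgebra ℂ (ToeplitzProduct A X) :=
  (NonUnitalStarAlgebra.adjoin ℂ
    (Set.range (toeplitzProductA A X) ∪ Set.range (toeplitzProductX A X))).topologicalClosure

/-- The Toeplitz algebra `𝒯(X)`. -/
abbrev ToeplitzAlgebra : Type (max (u + 1) (v + 1)) := toeplitzSubalgebra A X

instance : IsClosed (toeplitzSubalgebra A X : Set (ToeplitzProduct A X)) :=
  NonUnitalStarSubalgebra.isClosed_topologicalClosure _

instance : NonUnitalCStarAlgebra (ToeplitzAlgebra A X) :=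
  NonUnitalStarSubalgebra.nonUnitalCStarAlgebra _

/-- The canonical map `k_A : A → 𝒯(X)`. -/
def toeplitzA (a : A) : ToeplitzAlgebra A X :=
  ⟨toeplitzProductA A X a, NonUnitalStarSubalgebra.le_topologicalClosure _
    (NonUnitalStarAlgebra.subset_adjoin ℂ _ (Or.inl ⟨a, rfl⟩))⟩

/-- The canonical map `k_X : X → 𝒯(X)`. -/
def toeplitzX (x : X) : ToeplitzAlgebra A X :=
  ⟨toeplitzProductX A X x, NonUnitalStarSubalgebra.le_topologicalClosure _
    (NonUnitalStarAlgebra.subset_adjoin ℂ _ (Or.inr ⟨x, rfl⟩))⟩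

/-- The universal property: every Toeplitz representation factors through `𝒯(X)`. -/
theorem exists_toeplitzAlgebra_lift {B : Type (max u v)} [NonUnitalCStarAlgebra B]
    (R : ToeplitzRep A X B) : ∃ μ : ToeplitzAlgebra A X →⋆ₙₐ[ℂ] B,
      (∀ a, μ (toeplitzA A X a) = R.pi a) ∧ ∀ x, μ (toeplitzX A X x) = R.psi x :=
  ⟨{ toFun := fun t => (t : ToeplitzProduct A X) ⟨B, R⟩
     map_smul' := fun _ _ => rfl
     map_zero' := rfl
     map_add' := fun _ _ => rfl
     map_mul' := fun _ _ => rfl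
     map_star' := fun _ => rfl }, fun _ => rfl, fun _ => rfl⟩

end ToeplitzAlgebra

/-! ### Transfer operators and Toeplitz-covariant representations -/

/-- A transfer operator for `(A, α)`, where `α` is a (not necessarily unital or injective)
endomorphism of `A`. -/
structure TransferOperator {A : Type u} [CStarAlgebra A] [PartialOrder A]
    (α : A →⋆ₙₐ[ℂ] A) extends A →L[ℂ] A where
  map_nonneg' (a : A) : 0 ≤ a → 0 ≤ toFun a
  map_mul' (a b : A) : toFun (α a * b) = a * toFun b

instance {A : Type u} [CStarAlgebra A] [PartialOrder A] (α : A →⋆ₙₐ[ℂ] A) :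
    CoeFun (TransferOperator α) fun _ => A → A where
  coe L := L.toContinuousLinearMap

/-- A Toeplitz-covariant representation `(ρ, V)` of `(A, α, L)` in a unital C*-algebra `B`. -/
structure ToeplitzCovRep {A : Type u} [CStarAlgebra A] [PartialOrder A] {α : A →⋆ₙₐ[ℂ] A}
    (L : TransferOperator α) (B : Type w) [CStarAlgebra B] where
  rho : A →⋆ₐ[ℂ] B
  V : B
  tc1 (a : A) : V * rho a = rho (α a) * V
  tc2 (a : A) : star V * rho a * V = rho (L a)

/-- A nonzero unital C*-algebra (in the universe of `A`) together with a Toeplitz-covariant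
representation of `(A, α, L)` in it. -/
structure ToeplitzCovRepInto {A : Type u} [CStarAlgebra A] [PartialOrder A] {α : A →⋆ₙₐ[ℂ] A}
    (L : TransferOperator α) where
  B : Type u
  [alg : CStarAlgebra B]
  [nontrivial : Nontrivial B]
  rep : ToeplitzCovRep L B

attribute [instance] ToeplitzCovRepInto.alg ToeplitzCovRepInto.nontrivial

/-- The direct product of nonzero unital C*-algebras is a unital C*-algebra. -/
instance lpInftyCStarAlgebra {I : Type v} {B : I → Type w} [∀ i, CStarAlgebra (B i)]
    [∀ i, Nontrivial (B i)] : CStarAlgebra (lp B ∞) where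

section ExelToeplitz

variable {A : Type u} [CStarAlgebra A] [PartialOrder A] {α : A →⋆ₙₐ[ℂ] A}
  (L : TransferOperator α)

theorem ToeplitzCovRep.norm_V_le {L : TransferOperator α} {B : Type w} [CStarAlgebra B]
    (R : ToeplitzCovRep L B) : ‖R.V‖ ≤ √‖L 1‖ := by
  apply Real.le_sqrt_of_sq_le
  have h := R.tc2 1
  rw [map_one, mul_one] at h
  rw [sq, ← CStarRing.norm_star_mul_self, h]
  exact NonUnitalStarAlgHom.norm_apply_le R.rho _

/-- The direct product (bounded families, supremum norm) of the target algebras of all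
Toeplitz-covariant representations of `(A, α, L)`. -/
abbrev ExelProduct : Type (u + 1) :=
  lp (fun i : ToeplitzCovRepInto L => i.B) ∞

/-- The family `(ρ(a))` indexed by all Toeplitz-covariant representations `(ρ, V)`. -/
def exelProductA (a : A) : ExelProduct L :=
  ⟨fun i => i.rep.rho a, memℓp_infty ⟨‖a‖, by
    rintro _ ⟨i, rfl⟩
    exact NonUnitalStarAlgHom.norm_apply_le i.rep.rho a⟩⟩

/-- The family `(V)` indexed by all Toeplitz-covariant representations `(ρ, V)`. -/
def exelProductS : ExelProduct L :=
  ⟨fun i => i.rep.V, memℓp_infty ⟨√‖L 1‖, by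
    rintro _ ⟨i, rfl⟩
    exact i.rep.norm_V_le⟩⟩

/-- Exel's Toeplitz algebra `𝒯(A, α, L)`: the universal unital C*-algebra for Toeplitz-covariant
representations of `(A, α, L)`, as the unital C*-subalgebra generated by the product of all
Toeplitz-covariant representations. Thus the norm of a *-polynomial in the generators is the
supremum of its norms over all Toeplitz-covariant representations. (The C*-algebra generated by the
image of such a representation has at most `max(#A, 2)^ℵ₀` elements, so an isomorphic copy of it
lies in `Type u`; the zero algebra as a target contributes nothing.) -/
def exelSubalgebra : StarSubalgebra ℂ (ExelProduct L) :=
  (StarAlgebra.adjoin ℂ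
    (Set.range (exelProductA L) ∪ {exelProductS L})).topologicalClosure

/-- Exel's Toeplitz algebra `𝒯(A, α, L)`. -/
abbrev ExelToeplitzAlgebra : Type (u + 1) := exelSubalgebra L

instance : IsClosed (exelSubalgebra L : Set (ExelProduct L)) :=
  StarSubalgebra.isClosed_topologicalClosure _

instance : CStarAlgebra (ExelToeplitzAlgebra L) :=
  StarSubalgebra.cstarAlgebra _

/-- The canonical map `i_A : A → 𝒯(A, α, L)`. -/
def exelA (a : A) : ExelToeplitzAlgebra L :=
  ⟨exelProductA L a, StarSubalgebra.le_topologicalClosure _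
    (StarAlgebra.subset_adjoin ℂ _ (Or.inl ⟨a, rfl⟩))⟩

/-- The canonical element `S` of `𝒯(A, α, L)`. -/
def exelS : ExelToeplitzAlgebra L :=
  ⟨exelProductS L, StarSubalgebra.le_topologicalClosure _
    (StarAlgebra.subset_adjoin ℂ _ (Or.inr rfl))⟩

/-- The universal property: every Toeplitz-covariant representation factors through
`𝒯(A, α, L)`. -/
theorem exists_exelToeplitzAlgebra_lift {B : Type u} [CStarAlgebra B]
    (R : ToeplitzCovRep L B) : ∃ μ : ExelToeplitzAlgebra L →⋆ₐ[ℂ] B,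
      (∀ a, μ (exelA L a) = R.rho a) ∧ μ (exelS L) = R.V := by
  rcases subsingleton_or_nontrivial B with h | h
  · exact ⟨{ toFun := fun _ => 0
             map_one' := Subsingleton.elim _ _
             map_mul' := fun _ _ => Subsingleton.elim _ _
             map_zero' := rfl
             map_add' := fun _ _ => Subsingleton.elim _ _
             commutes' := fun _ => Subsingleton.elim _ _
             map_star' := fun _ => Subsingleton.elim _ _ },
      fun _ => Subsingleton.elim _ _, Subsingleton.elim _ _⟩
  · exact ⟨{ toFun := fun t => (t : ExelProduct L) ⟨B, R⟩
             map_one' := rfl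
             map_mul' := fun _ _ => rfl
             map_zero' := rfl
             map_add' := fun _ _ => rfl
             commutes' := fun _ => rfl
             map_star' := fun _ => rfl },
      fun _ => rfl, rfl⟩

end ExelToeplitz

/-! ### The Hilbert bimodule `M_L` -/

section ModuleML

variable {A : Type u} [CStarAlgebra A] [PartialOrder A] {α : A →⋆ₙₐ[ℂ] A}

/-- `A_L`: a copy of the vector space `A`, with the semi-inner product `⟨m, n⟩ = L(m* n)`. -/
def PreML (_L : TransferOperator α) : Type u := A

variable (L : TransferOperator α)

instance : AddCommGroup (PreML L) := inferInstanceAs (AddCommGroup A)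

instance : Module ℂ (PreML L) := inferInstanceAs (Module ℂ A)

/-- The identity map `A → A_L`. -/
def toPreML : A ≃ₗ[ℂ] PreML L := LinearEquiv.refl ℂ A

/-- The identity map `A_L → A`. -/
def ofPreML : PreML L ≃ₗ[ℂ] A := LinearEquiv.refl ℂ A

@[simp] theorem ofPreML_toPreML (a : A) : ofPreML L (toPreML L a) = a := rfl

/-- The `A`-valued semi-inner product `⟨m, n⟩ = L(m* n)` on `A_L`. -/
def preIp (m n : PreML L) : A := L (star (ofPreML L m) * ofPreML L n)

/-- The seminorm `‖m‖ = ‖⟨m, m⟩‖^{1/2}` on `A_L`. -/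
instance : Norm (PreML L) := ⟨fun m => √‖preIp L m m‖⟩

theorem preML_norm_def (m : PreML L) : ‖m‖ = √‖preIp L m m‖ := rfl

theorem preML_norm_sq (m : PreML L) : ‖m‖ ^ 2 = ‖preIp L m m‖ :=
  Real.sq_sqrt (norm_nonneg _)

theorem preIp_add (x y z : PreML L) : preIp L x (y + z) = preIp L x y + preIp L x z := by
  simp [preIp, mul_add]

theorem preIp_smul (c : ℂ) (x y : PreML L) : preIp L x (c • y) = c • preIp L x y := by
  simp [preIp]

theorem transfer_apply_mul (a b : A) : L (α a * b) = a * L b := L.map_mul' a b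

/-- The right action `m · a = m α(a)` on `A_L`. -/
def preRight (m : PreML L) (a : A) : PreML L := toPreML L (ofPreML L m * α a)

/-- The left action `a · m = a m` on `A_L`. -/
def preLeft (a : A) (m : PreML L) : PreML L := toPreML L (a * ofPreML L m)

theorem preIp_left (a : A) (x y : PreML L) :
    preIp L (preLeft L a x) y = preIp L x (preLeft L (star a) y) := by
  simp [preIp, preLeft, mul_assoc]

theorem transfer_nonneg {a : A} (h : 0 ≤ a) : 0 ≤ L a := L.map_nonneg' a h

variable [StarOrderedRing A]

/-- `L` as a bundled positive linear map. -/
def transferPos : A →ₚ[ℂ] A where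
  __ := L.toLinearMap
  monotone' a b h := by
    have := transfer_nonneg L (sub_nonneg.2 h)
    rw [map_sub] at this
    exact sub_nonneg.1 this

theorem transfer_star (a : A) : L (star a) = star (L a) := map_star (transferPos L) a

theorem transfer_mono {a b : A} (h : a ≤ b) : L a ≤ L b := (transferPos L).monotone' h

theorem transfer_mul_apply (a b : A) : L (b * α a) = L b * a := by
  have h := congrArg star (transfer_apply_mul L (star a) (star b))
  rw [← transfer_star] at h
  have hs : α (star a) = star (α a) := map_star α a
  simpa [← transfer_star, hs] using h

theorem star_preIp (x y : PreML L) : star (preIp L x y) = preIp L y x := by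
  simp [preIp, ← transfer_star]

theorem preIp_self_nonneg (x : PreML L) : 0 ≤ preIp L x x :=
  transfer_nonneg L (star_mul_self_nonneg _)

theorem preIp_right (x y : PreML L) (a : A) : preIp L x (preRight L y a) = preIp L x y * a := by
  simp [preIp, preRight, ← mul_assoc, transfer_mul_apply]

theorem preIp_right_left (x y : PreML L) (a : A) :
    preIp L (preRight L x a) y = star a * preIp L x y := by
  rw [← star_preIp, preIp_right, star_mul, star_preIp]

/-- The Cauchy-Schwarz inequality. -/
theorem norm_preIp_le (x y : PreML L) : ‖preIp L x y‖ ≤ ‖x‖ * ‖y‖ := by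
  set a := preIp L x y with ha
  have key : ∀ s : ℝ, ‖preIp L x x‖ < s → ‖a‖ ^ 2 ≤ s * ‖preIp L y y‖ := by
    intro s hs
    have hs0 : 0 < s := (norm_nonneg _).trans_lt hs
    have h1 : (0 : A) ≤ star a * preIp L x x * a - (s : ℂ) • (star a * a)
        - (s : ℂ) • (star a * a) + (s : ℂ) • (s : ℂ) • preIp L y y := by
      have := preIp_self_nonneg L (preRight L x a + (-s : ℂ) • y)
      have hc : ∀ z w : PreML L, preIp L (z + (-s : ℂ) • y) w
          = preIp L z w - (s : ℂ) • preIp L y w := by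
        intro z w
        rw [← star_preIp, preIp_add, preIp_smul, star_add, star_smul, star_preIp, star_preIp]
        simp [sub_eq_add_neg]
      rw [hc, preIp_add, preIp_add, preIp_smul, preIp_smul, preIp_right, preIp_right,
        preIp_right_left, preIp_right_left, ← ha, ← star_preIp L x y, ← ha] at this
      convert this using 1
      simp only [smul_add, neg_smul, smul_neg, mul_assoc]
      abel
    have h2 : star a * preIp L x x * a ≤ s • (star a * a) :=
      (CStarAlgebra.star_left_conjugate_le_norm_smul
        (IsSelfAdjoint.of_nonneg (preIp_self_nonneg L x))).trans
        (smul_le_smul_of_nonneg_right hs.le (star_mul_self_nonneg a))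
    simp only [Complex.coe_smul] at h1
    have h3 : s • (star a * a) ≤ s • s • preIp L y y := by
      rw [← sub_nonneg]
      refine h1.trans ?_
      have := sub_nonneg.2 h2
      rw [← sub_nonneg]
      convert this using 1
      abel
    have h4 : star a * a ≤ s • preIp L y y := (smul_le_smul_iff_of_pos_left hs0).1 h3
    have h5 := CStarAlgebra.norm_le_norm_of_nonneg_of_le (star_mul_self_nonneg a) h4
    rwa [CStarRing.norm_star_mul_self, ← sq, norm_smul, Real.norm_of_nonneg hs0.le] at h5
  have h6 : ‖a‖ ^ 2 ≤ ‖preIp L x x‖ * ‖preIp L y y‖ := by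
    refine ge_of_tendsto (f := fun s : ℝ => s * ‖preIp L y y‖)
      (x := nhdsWithin ‖preIp L x x‖ (Set.Ioi ‖preIp L x x‖)) ?_ ?_
    · exact ((continuous_id.mul continuous_const).tendsto _).mono_left nhdsWithin_le_nhds
    · filter_upwards [self_mem_nhdsWithin] with s hs using key s hs
  have hx : 0 ≤ ‖x‖ := Real.sqrt_nonneg _
  have hy : 0 ≤ ‖y‖ := Real.sqrt_nonneg _
  refine (sq_le_sq₀ (norm_nonneg _) (mul_nonneg hx hy)).1 ?_
  rwa [mul_pow, preML_norm_sq, preML_norm_sq]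

theorem preML_core : SeminormedSpace.Core ℂ (PreML L) where
  norm_nonneg _ := Real.sqrt_nonneg _
  norm_smul c x := by
    rw [preML_norm_def, preML_norm_def, preIp_smul, ← star_preIp, preIp_smul, star_smul,
      star_preIp, norm_smul, norm_smul, norm_star, ← mul_assoc,
      Real.sqrt_mul (mul_self_nonneg _), Real.sqrt_mul_self (norm_nonneg _)]
  norm_triangle x y := by
    have hn : ∀ z : PreML L, 0 ≤ ‖z‖ := fun z => Real.sqrt_nonneg _
    refine (sq_le_sq₀ (hn _) (add_nonneg (hn _) (hn _))).1 ?_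
    have hl : ∀ z : PreML L, preIp L (x + y) z = preIp L x z + preIp L y z := fun z => by
      rw [← star_preIp, preIp_add, star_add, star_preIp, star_preIp]
    rw [preML_norm_sq, preIp_add, hl, hl]
    have h1 := norm_add_le (preIp L x x + preIp L y x) (preIp L x y + preIp L y y)
    have h2 := norm_add_le (preIp L x x) (preIp L y x)
    have h3 := norm_add_le (preIp L x y) (preIp L y y)
    have h4 := norm_preIp_le L x y
    have h5 := norm_preIp_le L y x
    have h6 := preML_norm_sq L x
    have h7 := preML_norm_sq L y
    nlinarith

instance : SeminormedAddCommGroup (PreML L) := SeminormedAddCommGroup.ofCore (preML_core L)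

instance : NormedSpace ℂ (PreML L) where
  norm_smul_le c x := ((preML_core L).norm_smul c x).le

theorem norm_preRight_le (a : A) (m : PreML L) : ‖preRight L m a‖ ≤ ‖a‖ * ‖m‖ := by
  refine (sq_le_sq₀ (norm_nonneg _) (mul_nonneg (norm_nonneg _) (norm_nonneg _))).1 ?_
  rw [mul_pow, preML_norm_sq, preML_norm_sq, preIp_right, preIp_right_left]
  calc _ ≤ ‖star a‖ * ‖preIp L m m‖ * ‖a‖ := norm_mul₃_le
    _ = _ := by rw [norm_star]; ring

theorem norm_preLeft_le (a : A) (m : PreML L) : ‖preLeft L a m‖ ≤ ‖a‖ * ‖m‖ := by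
  refine (sq_le_sq₀ (norm_nonneg _) (mul_nonneg (norm_nonneg _) (norm_nonneg _))).1 ?_
  rw [mul_pow, preML_norm_sq, preML_norm_sq]
  have h : star (a * ofPreML L m) * (a * ofPreML L m)
      ≤ (‖a‖ ^ 2 : ℝ) • (star (ofPreML L m) * ofPreML L m) := by
    have := CStarAlgebra.star_left_conjugate_le_norm_smul (a := ofPreML L m) (b := star a * a)
      (IsSelfAdjoint.star_mul_self a)
    rw [CStarRing.norm_star_mul_self, ← sq] at this
    simpa [mul_assoc] using this
  have h2 := transfer_mono L h
  have h3 : L ((‖a‖ ^ 2 : ℝ) • (star (ofPreML L m) * ofPreML L m))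
      = (‖a‖ ^ 2 : ℝ) • preIp L m m := by
    rw [← Complex.coe_smul, map_smul, Complex.coe_smul]; rfl
  rw [h3] at h2
  have h4 := CStarAlgebra.norm_le_norm_of_nonneg_of_le
    (transfer_nonneg L (star_mul_self_nonneg _)) h2
  rwa [norm_smul, Real.norm_of_nonneg (sq_nonneg _)] at h4

/-- The right action of `a` on `A_L` as a bounded operator. -/
def preRightL (a : A) : PreML L →L[ℂ] PreML L :=
  LinearMap.mkContinuous
    { toFun := fun m => preRight L m a
      map_add' := fun x y => by simp [preRight, add_mul]
      map_smul' := fun c x => by simp [preRight] } ‖a‖ (norm_preRight_le L a)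

/-- The left action of `a` on `A_L` as a bounded operator. -/
def preLeftL (a : A) : PreML L →L[ℂ] PreML L :=
  LinearMap.mkContinuous
    { toFun := fun m => preLeft L a m
      map_add' := fun x y => by simp [preLeft, mul_add]
      map_smul' := fun c x => by simp [preLeft] } ‖a‖ (norm_preLeft_le L a)

/-- The semi-inner product of `A_L` as a biadditive map. -/
def preIpHom : PreML L →+ PreML L →+ A :=
  AddMonoidHom.mk' (fun x => AddMonoidHom.mk' (preIp L x) (preIp_add L x)) fun x y => by
    ext z
    change preIp L (x + y) z = preIp L x z + preIp L y z
    rw [← star_preIp, preIp_add, star_add, star_preIp, star_preIp]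

theorem continuous_preIp : Continuous fun p : PreML L × PreML L => preIp L p.1 p.2 := by
  let f : PreML L →ₗ⋆[ℂ] PreML L →ₗ[ℂ] A := LinearMap.mk₂'ₛₗ (starRingEnd ℂ) (RingHom.id ℂ)
    (preIp L)
    (fun x y z => by rw [← star_preIp, preIp_add, star_add, star_preIp, star_preIp])
    (fun c x y => by rw [← star_preIp, preIp_smul, star_smul, star_preIp]; rfl)
    (preIp_add L) (preIp_smul L)
  let g := f.mkContinuous₂ 1 fun x y => by rw [one_mul]; exact norm_preIp_le L x y
  exact (g.continuous.comp continuous_fst).clm_apply continuous_snd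

/-- The Hilbert `A`-module `M_L`: the (Hausdorff) completion of `A_L`, that is, the completion of
`A_L / N` where `N` is the subspace of vectors of seminorm `0`. -/
abbrev ML : Type u := UniformSpace.Completion (PreML L)

/-- The canonical map `q : A → M_L`, with dense range and `⟨q(a), q(b)⟩ = L(a* b)`. -/
def qML (a : A) : ML L := ((toPreML L a : PreML L) : UniformSpace.Completion (PreML L))

/-- The inner product of `M_L`, extended from `A_L` by continuity. -/
def ipML (x y : ML L) : A :=
  ((UniformSpace.Completion.isDenseInducing_toCompl (PreML L)).prodMap (UniformSpace.Completion.isDenseInducing_toCompl (PreML L))).extend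
    (fun p : PreML L × PreML L => preIpHom L p.1 p.2) (x, y)

theorem continuous_ipML : Continuous fun p : ML L × ML L => ipML L p.1 p.2 :=
  (UniformSpace.Completion.isDenseInducing_toCompl (PreML L)).extend_Z_bilin (UniformSpace.Completion.isDenseInducing_toCompl (PreML L))
    (continuous_preIp L)

theorem ipML_coe (x y : PreML L) : ipML L (x : ML L) (y : ML L) = preIp L x y :=
  ((UniformSpace.Completion.isDenseInducing_toCompl (PreML L)).prodMap
    (UniformSpace.Completion.isDenseInducing_toCompl (PreML L))).extend_eq
    (continuous_preIp L) (x, y)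

@[fun_prop]
theorem Continuous.ipML {Y : Type w} [TopologicalSpace Y] {f g : Y → ML L} (hf : Continuous f)
    (hg : Continuous g) : Continuous fun y => ipML L (f y) (g y) :=
  (continuous_ipML L).comp (hf.prodMk hg)

/-- The right action of `a` on `M_L`: the continuous extension of `q(m) · a = q(m α(a))`. -/
def rightML (a : A) : ML L →L[ℂ] ML L := (preRightL L a).completion

/-- The left action of `a` on `M_L`: the continuous extension of `a · q(m) = q(a m)`. -/
def leftML (a : A) : ML L →L[ℂ] ML L := (preLeftL L a).completion

theorem rightML_coe (a : A) (x : PreML L) :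
    rightML L a (x : ML L) = ((preRight L x a : PreML L) : ML L) :=
  (preRightL L a).completion_apply_coe x

theorem leftML_coe (a : A) (x : PreML L) :
    leftML L a (x : ML L) = ((preLeft L a x : PreML L) : ML L) :=
  (preLeftL L a).completion_apply_coe x

/-- Continuous maps on `M_L` that agree on `A_L` are equal. -/
theorem ML_ext {f g : ML L → ML L} (hf : Continuous f) (hg : Continuous g)
    (h : ∀ x : PreML L, f (x : ML L) = g (x : ML L)) (x : ML L) : f x = g x :=
  UniformSpace.Completion.induction_on x (isClosed_eq hf hg) h

open UniformSpace.Completion in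
/-- `M_L` is a Hilbert bimodule over `A`. -/
instance : HilbertBimodule A (ML L) where
  ip := ipML L
  right x a := rightML L a x
  left a x := leftML L a x
  complete := inferInstance
  right_add x a b := by
    refine ML_ext L (rightML L (a + b)).continuous
      ((rightML L a).continuous.add (rightML L b).continuous) (fun x => ?_) x
    rw [Pi.add_apply, rightML_coe, rightML_coe, rightML_coe, ← coe_add]
    simp [preRight, mul_add]
  add_right x y a := map_add _ _ _
  right_smul c x a := by
    refine ML_ext L (rightML L (c • a)).continuous
      ((rightML L a).continuous.const_smul c) (fun x => ?_) x
    rw [Pi.smul_apply, rightML_coe, rightML_coe, ← coe_smul]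
    simp [preRight]
  smul_right c x a := map_smul _ _ _
  right_mul x a b := by
    refine ML_ext L (rightML L (a * b)).continuous
      ((rightML L b).continuous.comp (rightML L a).continuous) (fun x => ?_) x
    rw [Function.comp_apply, rightML_coe, rightML_coe, rightML_coe]
    simp [preRight, mul_assoc]
  ip_add x y z := by
    induction x, y, z using induction_on₃ with
    | hp => apply isClosed_eq <;> fun_prop
    | ih x y z => rw [← coe_add, ipML_coe, ipML_coe, ipML_coe, preIp_add]
  ip_smul c x y := by
    induction x, y using induction_on₂ with
    | hp =>
      exact isClosed_eq (Continuous.ipML L continuous_fst (continuous_snd.const_smul c))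
        ((Continuous.ipML L continuous_fst continuous_snd).const_smul c)
    | ih x y => rw [← coe_smul, ipML_coe, ipML_coe, preIp_smul]
  ip_right x y a := by
    induction x, y using induction_on₂ with
    | hp =>
      exact isClosed_eq
        (Continuous.ipML L continuous_fst ((rightML L a).continuous.comp continuous_snd))
        ((Continuous.ipML L continuous_fst continuous_snd).mul continuous_const)
    | ih x y => rw [rightML_coe, ipML_coe, ipML_coe, preIp_right]
  star_ip x y := by
    induction x, y using induction_on₂ with
    | hp =>
      exact isClosed_eq (Continuous.ipML L continuous_fst continuous_snd).star
        (Continuous.ipML L continuous_snd continuous_fst)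
    | ih x y => rw [ipML_coe, ipML_coe, star_preIp]
  ip_self_nonneg x := by
    induction x using induction_on with
    | hp => exact isClosed_le continuous_const (Continuous.ipML L continuous_id continuous_id)
    | ih x => rw [ipML_coe]; exact preIp_self_nonneg L x
  norm_eq x := by
    induction x using induction_on with
    | hp =>
      exact isClosed_eq continuous_norm
        (Continuous.ipML L continuous_id continuous_id).norm.sqrt
    | ih x => rw [ipML_coe, norm_coe, preML_norm_def]
  left_add a x y := map_add _ _ _
  left_smul c a x := map_smul _ _ _
  add_left a b x := by
    refine ML_ext L (leftML L (a + b)).continuous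
      ((leftML L a).continuous.add (leftML L b).continuous) (fun x => ?_) x
    rw [Pi.add_apply, leftML_coe, leftML_coe, leftML_coe, ← coe_add]
    simp [preLeft, add_mul]
  smul_left c a x := by
    refine ML_ext L (leftML L (c • a)).continuous
      ((leftML L a).continuous.const_smul c) (fun x => ?_) x
    rw [Pi.smul_apply, leftML_coe, leftML_coe, ← coe_smul]
    simp [preLeft]
  mul_left a b x := by
    refine ML_ext L (leftML L (a * b)).continuous
      ((leftML L a).continuous.comp (leftML L b).continuous) (fun x => ?_) x
    rw [Function.comp_apply, leftML_coe, leftML_coe, leftML_coe]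
    simp [preLeft, mul_assoc]
  ip_left a x y := by
    induction x, y using induction_on₂ with
    | hp =>
      exact isClosed_eq
        (Continuous.ipML L ((leftML L a).continuous.comp continuous_fst) continuous_snd)
        (Continuous.ipML L continuous_fst ((leftML L (star a)).continuous.comp continuous_snd))
    | ih x y => rw [leftML_coe, leftML_coe, ipML_coe, ipML_coe, preIp_left]

end ModuleML

end

/-! ### Density of `q(A)` and automatic continuity. -/

noncomputable section

/-! The bimodule `M_L` is topologically generated by the single vector `q(1)`, because `q(a) = a ·
q(1)`. So a Toeplitz representation `(ψ, π)` is determined by `π` and `V = ψ(q(1))`. The relations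
for `V` are the bimodule relations at `q(1)`: `q(1) · a = q(α(a)) = α(a) · q(1)` gives `tc1`, and
`⟨q(1), a · q(1)⟩ = L(a)` gives `tc2`. Conversely, `tc2` gives `‖ρ(a)V‖² = ‖ρ(L(a*a))‖ ≤ ‖q(a)‖²`,
so `q(a) ↦ ρ(a)V` extends to `M_L`, and the Toeplitz relations pass from the dense set `q(A)` to all
of `M_L` by continuity.

For the isomorphism, the obstacle is that `𝒯(M_L)` is universal for representations with `π` not
necessarily unital. But `1` acts as the identity on both sides of `M_L` (`rightML_one`,
`leftML_one`), on the right even when `α(1) ≠ 1`. Hence every Toeplitz representation lives in the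
corner `π(1)Bπ(1)`, where it is unital and the correspondence applies
(`ToeplitzRep.exists_exel_lift`). Each universal algebra therefore maps to the other, and the two
maps are mutually inverse because both composites fix generators.

The universal algebras lie one universe above the targets of their universal properties. The maps
between them are therefore assembled coordinate by coordinate into the product, and then shown to
land in the generated subalgebra. -/

theorem denseRange_qML {A : Type u} [CStarAlgebra A] [PartialOrder A] [StarOrderedRing A]
    {α : A →⋆ₙₐ[ℂ] A} (L : TransferOperator α) : DenseRange (qML L) :=
  UniformSpace.Completion.denseRange_coe (α := PreML L)

theorem continuous_starAlgHom {B : Type u} {C : Type v} [NonUnitalCStarAlgebra B]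
    [NonUnitalCStarAlgebra C] (f : B →⋆ₙₐ[ℂ] C) : Continuous f :=
  AddMonoidHomClass.continuous_of_bound f 1 fun b => by
    rw [one_mul]; exact NonUnitalStarAlgHom.norm_apply_le f b

theorem ToeplitzRep.continuous_psi {A : Type u} {X : Type v} [NonUnitalCStarAlgebra A]
    [PartialOrder A] [NormedAddCommGroup X] [NormedSpace ℂ X] [HilbertBimodule A X]
    {B : Type w} [NonUnitalCStarAlgebra B] (R : ToeplitzRep A X B) :
    Continuous R.psi :=
  (R.psi.mkContinuous 1 fun x => by rw [one_mul]; exact R.norm_psi_le x).continuous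

theorem ToeplitzRep.ext' {A : Type u} {X : Type v} [NonUnitalCStarAlgebra A]
    [PartialOrder A] [NormedAddCommGroup X] [NormedSpace ℂ X] [HilbertBimodule A X]
    {B : Type w} [NonUnitalCStarAlgebra B] {R R' : ToeplitzRep A X B}
    (hpi : ∀ a, R.pi a = R'.pi a) (hpsi : ∀ x, R.psi x = R'.psi x) : R = R' := by
  cases R; cases R'
  obtain rfl := NonUnitalStarAlgHom.ext hpi
  obtain rfl := LinearMap.ext hpsi
  rfl

/-! ### The correspondence between `(ρ, V)` and `(ψ, π)`. -/

section Representations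

variable {A : Type u} [CStarAlgebra A] [PartialOrder A]

theorem ToeplitzCovRep.ext' {α : A →⋆ₙₐ[ℂ] A} {L : TransferOperator α} {B : Type w}
    [CStarAlgebra B] {W W' : ToeplitzCovRep L B} (hrho : ∀ a, W.rho a = W'.rho a)
    (hV : W.V = W'.V) : W = W' := by
  cases W; cases W'
  obtain rfl := StarAlgHom.ext hrho
  obtain rfl := hV
  rfl

/-- The covariance `tc2` at `a* b`. It yields both the bound needed to extend `q(a) ↦ ρ(a)V` to
`M_L` and the inner product relation of the extension. -/
theorem ToeplitzCovRep.star_mul_rho_mul {α : A →⋆ₙₐ[ℂ] A} {L : TransferOperator α}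
    {B : Type w} [CStarAlgebra B] (W : ToeplitzCovRep L B) (a b : A) :
    star (W.rho a * W.V) * (W.rho b * W.V) = W.rho (L (star a * b)) := by
  rw [← W.tc2, map_mul, map_star, star_mul]
  simp only [mul_assoc]

variable [StarOrderedRing A] {α : A →⋆ₙₐ[ℂ] A} (L : TransferOperator α)

theorem leftML_qML (a b : A) : HilbertBimodule.left a (qML L b) = qML L (a * b) :=
  leftML_coe L a _

theorem rightML_qML (a b : A) : HilbertBimodule.right (qML L b) a = qML L (b * α a) :=
  rightML_coe L a _

theorem ipML_qML (a b : A) :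
    HilbertBimodule.ip (A := A) (qML L a) (qML L b) = L (star a * b) :=
  ipML_coe L _ _

theorem continuous_leftML (a : A) :
    Continuous fun x : ML L => HilbertBimodule.left a x := (leftML L a).continuous

theorem continuous_rightML (a : A) :
    Continuous fun x : ML L => HilbertBimodule.right x a := (rightML L a).continuous

/-- The unit of `A` acts trivially on the right of `M_L`, even if `α` is not unital. -/
theorem rightML_one (x : ML L) : HilbertBimodule.right x (1 : A) = x := by
  set y := HilbertBimodule.right x (1 : A) - x with hy
  have h1 : HilbertBimodule.ip (A := A) y y = 0 := by
    -- Since `⟨z, x · 1⟩ = ⟨z, x⟩ 1`, the difference `y` is orthogonal to every `z`, in particular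
    -- to itself; the value of `α(1)` plays no role.
    have h2 : ∀ z : ML L, HilbertBimodule.ip (A := A) z y = 0 := fun z => by
      have h3 := HilbertBimodule.ip_add (A := A) z y x
      rw [hy, sub_add_cancel, HilbertBimodule.ip_right, mul_one] at h3
      exact right_eq_add.1 h3
    exact h2 y
  have h4 : ‖y‖ = 0 := by
    rw [HilbertBimodule.norm_eq (A := A), h1, norm_zero, Real.sqrt_zero]
  exact sub_eq_zero.1 (norm_eq_zero.1 h4)

theorem leftML_one (x : ML L) : HilbertBimodule.left (1 : A) x = x :=
  congrFun ((denseRange_qML L).equalizer (continuous_leftML L 1) continuous_id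
    (funext fun a => by simp [leftML_qML])) x

namespace ToeplitzCovRep

variable {L} {B : Type w} [CStarAlgebra B] (W : ToeplitzCovRep L B)

/-- The bounded linear map `q(a) ↦ ρ(a) V` on `A_L`. -/
def prePsi : PreML L →L[ℂ] B :=
  LinearMap.mkContinuous
    { toFun := fun m => W.rho (ofPreML L m) * W.V
      map_add' := fun x y => by rw [map_add, map_add, add_mul]
      map_smul' := fun c x => by rw [map_smul, map_smul, smul_mul_assoc, RingHom.id_apply] }
    1 fun m => by
      refine (sq_le_sq₀ (norm_nonneg _) (by positivity)).1 ?_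
      rw [one_mul, preML_norm_sq, sq, ← CStarRing.norm_star_mul_self]
      change ‖star (W.rho (ofPreML L m) * W.V) * (W.rho (ofPreML L m) * W.V)‖ ≤ _
      rw [star_mul_rho_mul]
      exact NonUnitalStarAlgHom.norm_apply_le W.rho _

/-- The bounded linear map `ψ` on `M_L` with `ψ(q(a)) = ρ(a) V`. -/
def psi : ML L →L[ℂ] B :=
  W.prePsi.extend UniformSpace.Completion.toComplL

theorem psi_qML (a : A) : W.psi (qML L a) = W.rho a * W.V :=
  W.prePsi.extend_eq UniformSpace.Completion.denseRange_coe
    (UniformSpace.Completion.isUniformInducing_coe _) (toPreML L a)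

/-- The Toeplitz representation `(ψ, ρ)` of `M_L` associated with `(ρ, V)`. -/
def toToeplitzRep : ToeplitzRep A (ML L) B where
  psi := W.psi
  pi := W.rho
  -- Both sides of each relation are continuous, so it suffices to compare them on `q(A)`; here that
  -- is `tc1`.
  psi_right x a := congrFun ((denseRange_qML L).equalizer
    (g := fun x => W.psi (HilbertBimodule.right x a)) (h := fun x => W.psi x * W.rho a)
    (W.psi.continuous.comp (continuous_rightML L a)) (W.psi.continuous.mul continuous_const)
    (funext fun b => by simp [rightML_qML, psi_qML, mul_assoc, W.tc1])) x
  -- Density of `q(A) × q(A)` handles both variables at once.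
  star_psi_mul x y := congrFun (((denseRange_qML L).prodMap (denseRange_qML L)).equalizer
    (g := fun p : ML L × ML L => star (W.psi p.1) * W.psi p.2)
    (h := fun p => W.rho (HilbertBimodule.ip p.1 p.2))
    ((W.psi.continuous.comp continuous_fst).star.mul (W.psi.continuous.comp continuous_snd))
    ((continuous_starAlgHom (W.rho : A →⋆ₙₐ[ℂ] B)).comp (continuous_ipML L))
    (funext fun p => by
      simp only [Function.comp_apply, Prod.map_fst, Prod.map_snd, psi_qML, ipML_qML,
        star_mul_rho_mul])) (x, y)
  psi_left a x := congrFun ((denseRange_qML L).equalizer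
    (g := fun x => W.psi (HilbertBimodule.left a x)) (h := fun x => W.rho a * W.psi x)
    (W.psi.continuous.comp (continuous_leftML L a)) (continuous_const.mul W.psi.continuous)
    (funext fun b => by simp [leftML_qML, psi_qML, mul_assoc])) x

end ToeplitzCovRep

namespace ToeplitzRep

variable {L}

/-- Cyclicity of `q(1)` for the left action, seen through `ψ`. -/
theorem psi_qML {B : Type w} [NonUnitalCStarAlgebra B] (R : ToeplitzRep A (ML L) B) (a : A) :
    R.psi (qML L a) = R.pi a * R.psi (qML L 1) := by
  rw [← R.psi_left, leftML_qML, mul_one]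

/-- Together with `pi_one_mul_psi`, this puts the range of `ψ` in the corner at `π(1)`. -/
theorem psi_mul_pi_one {B : Type w} [NonUnitalCStarAlgebra B] (R : ToeplitzRep A (ML L) B)
    (x : ML L) : R.psi x * R.pi 1 = R.psi x := by
  rw [← R.psi_right, rightML_one]

theorem pi_one_mul_psi {B : Type w} [NonUnitalCStarAlgebra B] (R : ToeplitzRep A (ML L) B)
    (x : ML L) : R.pi 1 * R.psi x = R.psi x := by
  rw [← R.psi_left, leftML_one]

/-- The Toeplitz-covariant representation `(π, ψ(q(1)))` associated with `(ψ, π)`. -/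
def toToeplitzCovRep {B : Type w} [CStarAlgebra B] (R : ToeplitzRep A (ML L) B)
    (h : R.pi 1 = 1) : ToeplitzCovRep L B where
  rho :=
    { R.pi with
      map_one' := h
      commutes' := fun c => by
        change R.pi (algebraMap ℂ A c) = algebraMap ℂ B c
        rw [Algebra.algebraMap_eq_smul_one, map_smul, h, Algebra.algebraMap_eq_smul_one] }
  V := R.psi (qML L 1)
  -- The vector `q(α(a))` is both `q(1) · a` and `α(a) · q(1)`.
  tc1 a := by
    change R.psi (qML L 1) * R.pi a = R.pi (α a) * R.psi (qML L 1)
    rw [← R.psi_right, rightML_qML, one_mul, R.psi_qML]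
  tc2 a := by
    change star (R.psi (qML L 1)) * R.pi a * R.psi (qML L 1) = R.pi (L a)
    rw [mul_assoc, ← R.psi_qML, R.star_psi_mul, ipML_qML, star_one, one_mul]

end ToeplitzRep

end Representations

/-! ### Homomorphisms into products. -/

section LpPi

variable {I : Type v} {B : I → Type w} [∀ i, NonUnitalCStarAlgebra (B i)]

/-- A family of *-homomorphisms as a *-homomorphism into the product of C*-algebras. -/
def lpInftyPi {C : Type u} [NonUnitalCStarAlgebra C] (f : ∀ i, C →⋆ₙₐ[ℂ] B i) :
    C →⋆ₙₐ[ℂ] lp B ∞ where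
  toFun c := ⟨fun i => f i c, memℓp_infty ⟨‖c‖, by
    rintro _ ⟨i, rfl⟩
    exact NonUnitalStarAlgHom.norm_apply_le (f i) c⟩⟩
  map_smul' r c := lp.ext (funext fun i => map_smul (f i) r c)
  map_zero' := lp.ext (funext fun i => map_zero (f i))
  map_add' c d := lp.ext (funext fun i => map_add (f i) c d)
  map_mul' c d := lp.ext (funext fun i => map_mul (f i) c d)
  map_star' c := lp.ext (funext fun i => map_star (f i) c)

end LpPi

/-! ### Corners as unital C*-algebras. -/

section Corner

variable {B : Type u} [NonUnitalCStarAlgebra B]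

/-- The corner `pBp` of a C*-algebra at a self-adjoint element `p`. -/
def cornerSubalgebra (p : B) (hs : star p = p) : NonUnitalStarSubalgebra ℂ B where
  carrier := {b | p * b = b ∧ b * p = b}
  add_mem' := fun {a b} ha hb => ⟨by rw [mul_add, ha.1, hb.1], by rw [add_mul, ha.2, hb.2]⟩
  zero_mem' := ⟨mul_zero _, zero_mul _⟩
  mul_mem' := fun {a b} ha hb => ⟨by rw [← mul_assoc, ha.1], by rw [mul_assoc, hb.2]⟩
  smul_mem' := fun c a ha => ⟨by rw [mul_smul_comm, ha.1], by rw [smul_mul_assoc, ha.2]⟩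
  star_mem' := fun {a} ha => ⟨by
    have h := congrArg star ha.2
    rwa [star_mul, hs] at h, by
    have h := congrArg star ha.1
    rwa [star_mul, hs] at h⟩

theorem isClosed_cornerSubalgebra (p : B) (hs : star p = p) :
    IsClosed (cornerSubalgebra p hs : Set B) :=
  (isClosed_eq (continuous_const.mul continuous_id) continuous_id).inter
    (isClosed_eq (continuous_id.mul continuous_const) continuous_id)

/-- A C*-algebra with a two-sided unit is a unital C*-algebra. -/
@[reducible] def cstarAlgebraOfUnit (e : B) (hl : ∀ b, e * b = b) (hr : ∀ b, b * e = b) :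
    CStarAlgebra B :=
  letI : NormedRing B :=
    { ‹NonUnitalCStarAlgebra B›.toNonUnitalNormedRing with
      one := e
      one_mul := hl
      mul_one := hr }
  -- The algebra structure is built on the existing scalar action, so only the unit is new and the
  -- inclusion of a corner remains a *-homomorphism.
  letI : Algebra ℂ B := Algebra.ofModule smul_mul_assoc mul_smul_comm
  { ‹NonUnitalCStarAlgebra B› with
    one := e
    one_mul := hl
    mul_one := hr
    algebraMap := algebraMap ℂ B
    smul := fun c b => c • b
    commutes' := Algebra.commutes
    smul_def' := Algebra.smul_def
    norm_smul_le := norm_smul_le }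

end Corner

/-! ### Generation of the universal algebras. -/

section Generation

/-- Closed non-unital *-subalgebras suffice, since `i_A(1)` is already the unit. This allows
arguments with homomorphisms not known to be unital. -/
theorem mem_of_isClosed_of_exel {A : Type u} [CStarAlgebra A] [PartialOrder A]
    {α : A →⋆ₙₐ[ℂ] A} (L : TransferOperator α)
    (T : NonUnitalStarSubalgebra ℂ (ExelToeplitzAlgebra L))
    (hT : IsClosed (T : Set (ExelToeplitzAlgebra L))) (hA : ∀ a, exelA L a ∈ T)
    (hS : exelS L ∈ T) (x : ExelToeplitzAlgebra L) : x ∈ T := by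
  -- `𝒯(A, α, L)` is closed in the product, so sets closed in it are closed in the product.
  have hc : IsClosed (Subtype.val '' (T : Set (ExelToeplitzAlgebra L))) :=
    (StarSubalgebra.isClosed_topologicalClosure _).isClosedEmbedding_subtypeVal.isClosedMap _ hT
  have hsub : ((StarAlgebra.adjoin ℂ (Set.range (exelProductA L) ∪ {exelProductS L}) :
      StarSubalgebra ℂ (ExelProduct L)) : Set (ExelProduct L)) ⊆
      Subtype.val '' (T : Set (ExelToeplitzAlgebra L)) := by
    intro y hy
    induction hy using StarAlgebra.adjoin_induction with
    | mem y h =>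
      rcases h with ⟨a, rfl⟩ | rfl
      · exact ⟨exelA L a, hA a, rfl⟩
      · exact ⟨exelS L, hS, rfl⟩
    | algebraMap r =>
      -- Every `ρ` is unital, so `i_A(1) = 1` and scalars lie in the span of `i_A(1)`.
      refine ⟨r • exelA L 1, T.smul_mem r (hA 1), ?_⟩
      rw [Algebra.algebraMap_eq_smul_one]
      exact congrArg (r • ·) (lp.ext (funext fun i => map_one i.rep.rho))
    | add y z _ _ hy hz =>
      obtain ⟨y, hy, rfl⟩ := hy
      obtain ⟨z, hz, rfl⟩ := hz
      exact ⟨y + z, T.add_mem hy hz, rfl⟩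
    | mul y z _ _ hy hz =>
      obtain ⟨y, hy, rfl⟩ := hy
      obtain ⟨z, hz, rfl⟩ := hz
      exact ⟨y * z, T.mul_mem hy hz, rfl⟩
    | star y _ hy =>
      obtain ⟨y, hy, rfl⟩ := hy
      exact ⟨star y, star_mem (s := T) hy, rfl⟩
  obtain ⟨y, hy, hyx⟩ := closure_minimal hsub hc x.2
  rwa [← Subtype.ext hyx]

theorem mem_of_isClosed_of_toeplitz {A : Type u} {X : Type v} [NonUnitalCStarAlgebra A]
    [PartialOrder A] [NormedAddCommGroup X] [NormedSpace ℂ X] [HilbertBimodule A X]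
    (T : NonUnitalStarSubalgebra ℂ (ToeplitzAlgebra A X))
    (hT : IsClosed (T : Set (ToeplitzAlgebra A X))) (hA : ∀ a, toeplitzA A X a ∈ T)
    (hX : ∀ x, toeplitzX A X x ∈ T) (x : ToeplitzAlgebra A X) : x ∈ T := by
  have hc : IsClosed (Subtype.val '' (T : Set (ToeplitzAlgebra A X))) :=
    (NonUnitalStarSubalgebra.isClosed_topologicalClosure _).isClosedEmbedding_subtypeVal.isClosedMap
      _ hT
  have hsub : NonUnitalStarAlgebra.adjoin ℂ
      (Set.range (toeplitzProductA A X) ∪ Set.range (toeplitzProductX A X)) ≤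
      T.map (NonUnitalStarSubalgebraClass.subtype (toeplitzSubalgebra A X)) := by
    refine NonUnitalStarAlgebra.adjoin_le ?_
    rintro _ (⟨a, rfl⟩ | ⟨x, rfl⟩)
    · exact ⟨toeplitzA A X a, hA a, rfl⟩
    · exact ⟨toeplitzX A X x, hX x, rfl⟩
  obtain ⟨y, hy, hyx⟩ := closure_minimal (fun z hz => hsub hz) hc x.2
  rwa [← Subtype.ext hyx]

/-- The Toeplitz relations hold in each coordinate, so the universal pair is itself a Toeplitz
representation and its `ψ` is contractive. -/
theorem continuous_toeplitzX {A : Type u} {X : Type v} [NonUnitalCStarAlgebra A]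
    [PartialOrder A] [NormedAddCommGroup X] [NormedSpace ℂ X]
    [HilbertBimodule A X] : Continuous (toeplitzX A X) := by
  let R : ToeplitzRep A X (ToeplitzAlgebra A X) :=
    { psi :=
        { toFun := toeplitzX A X
          map_add' := fun x y => Subtype.ext (lp.ext (funext fun i => map_add i.rep.psi x y))
          map_smul' := fun c x => Subtype.ext (lp.ext (funext fun i => map_smul i.rep.psi c x)) }
      pi :=
        { toFun := toeplitzA A X
          map_smul' := fun c x => Subtype.ext (lp.ext (funext fun i => map_smul i.rep.pi c x))
          map_zero' := Subtype.ext (lp.ext (funext fun i => map_zero i.rep.pi))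
          map_add' := fun x y => Subtype.ext (lp.ext (funext fun i => map_add i.rep.pi x y))
          map_mul' := fun x y => Subtype.ext (lp.ext (funext fun i => map_mul i.rep.pi x y))
          map_star' := fun x => Subtype.ext (lp.ext (funext fun i => map_star i.rep.pi x)) }
      psi_right := fun x a => Subtype.ext (lp.ext (funext fun i => i.rep.psi_right x a))
      star_psi_mul := fun x y => Subtype.ext (lp.ext (funext fun i => i.rep.star_psi_mul x y))
      psi_left := fun a x => Subtype.ext (lp.ext (funext fun i => i.rep.psi_left a x)) }
  exact R.continuous_psi

/-- Combined with the generation lemmas, this reduces equality of two homomorphisms to equality on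
generators. -/
theorem isClosed_equalizer {C : Type u} {D : Type v} [NonUnitalCStarAlgebra C]
    [NonUnitalCStarAlgebra D] (f g : C →⋆ₙₐ[ℂ] D) :
    IsClosed ((NonUnitalStarAlgHom.equalizer f g : NonUnitalStarSubalgebra ℂ C) : Set C) :=
  isClosed_eq (continuous_starAlgHom f) (continuous_starAlgHom g)

end Generation

/-! ### The isomorphism of `𝒯(A, α, L)` with `𝒯(M_L)`. -/

section Isomorphism

variable {A : Type u} [CStarAlgebra A] [PartialOrder A] [StarOrderedRing A]
  {α : A →⋆ₙₐ[ℂ] A} {L : TransferOperator α}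

/-- A Toeplitz representation of `M_L`, unital or not, factors through `𝒯(A, α, L)`. -/
theorem ToeplitzRep.exists_exel_lift {B : Type u} [NonUnitalCStarAlgebra B]
    (R : ToeplitzRep A (ML L) B) : ∃ μ : ExelToeplitzAlgebra L →⋆ₙₐ[ℂ] B,
      (∀ a, μ (exelA L a) = R.pi a) ∧ μ (exelS L) = R.psi (qML L 1) := by
  have hs : star (R.pi 1) = R.pi 1 := by rw [← map_star, star_one]
  let C := cornerSubalgebra (R.pi 1) hs
  have hC : IsClosed (C : Set B) := isClosed_cornerSubalgebra _ hs
  have hpi : ∀ a, R.pi a ∈ C := fun a => ⟨by rw [← map_mul, one_mul], by rw [← map_mul, mul_one]⟩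
  have hpsi : ∀ x, R.psi x ∈ C := fun x => ⟨R.pi_one_mul_psi x, R.psi_mul_pi_one x⟩
  let _ : NonUnitalCStarAlgebra C := NonUnitalStarSubalgebra.nonUnitalCStarAlgebra C
  let _ : CStarAlgebra C := cstarAlgebraOfUnit ⟨R.pi 1, hpi 1⟩
    (fun b => Subtype.ext b.2.1) (fun b => Subtype.ext b.2.2)
  let R' : ToeplitzRep A (ML L) C :=
    { psi := LinearMap.codRestrict C.toSubmodule R.psi hpsi
      pi := NonUnitalStarAlgHom.codRestrict R.pi C hpi
      psi_right := fun x a => Subtype.ext (R.psi_right x a)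
      star_psi_mul := fun x y => Subtype.ext (R.star_psi_mul x y)
      psi_left := fun a x => Subtype.ext (R.psi_left a x) }
  -- In the corner the unit is `π(1)` by construction. The corner may be zero, a case that
  -- `exists_exelToeplitzAlgebra_lift` includes.
  obtain ⟨μ, hμA, hμS⟩ := exists_exelToeplitzAlgebra_lift L (R'.toToeplitzCovRep rfl)
  refine ⟨(NonUnitalStarSubalgebraClass.subtype C).comp
    (μ : ExelToeplitzAlgebra L →⋆ₙₐ[ℂ] C), fun a => ?_, ?_⟩
  · exact congrArg Subtype.val (hμA a)
  · exact congrArg Subtype.val hμS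

variable (L)

/-- Each coordinate of `𝒯(M_L)` is a possibly non-unital Toeplitz representation, hence receives
`𝒯(A, α, L)` through its corner; the product of these maps sends generators into `𝒯(M_L)`. -/
theorem exists_exel_to_toeplitz : ∃ θ : ExelToeplitzAlgebra L →⋆ₙₐ[ℂ] ToeplitzAlgebra A (ML L),
    (∀ a, θ (exelA L a) = toeplitzA A (ML L) a) ∧
      θ (exelS L) = toeplitzX A (ML L) (qML L 1) := by
  choose μ hA hS using fun i : ToeplitzRepInto A (ML L) => i.rep.exists_exel_lift
  have hA' : ∀ a, lpInftyPi μ (exelA L a) = toeplitzProductA A (ML L) a := fun a =>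
    lp.ext (funext fun i => hA i a)
  have hS' : lpInftyPi μ (exelS L) = toeplitzProductX A (ML L) (qML L 1) :=
    lp.ext (funext fun i => hS i)
  have hmem : ∀ x, lpInftyPi μ x ∈ toeplitzSubalgebra A (ML L) := fun x =>
    mem_of_isClosed_of_exel L ((toeplitzSubalgebra A (ML L)).comap (lpInftyPi μ))
      (IsClosed.preimage (continuous_starAlgHom (lpInftyPi μ))
        (NonUnitalStarSubalgebra.isClosed_topologicalClosure _))
      (fun a => by
        change lpInftyPi μ (exelA L a) ∈ toeplitzSubalgebra A (ML L)
        rw [hA']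
        exact (toeplitzA A (ML L) a).2)
      (by
        change lpInftyPi μ (exelS L) ∈ toeplitzSubalgebra A (ML L)
        rw [hS']
        exact (toeplitzX A (ML L) (qML L 1)).2) x
  exact ⟨NonUnitalStarAlgHom.codRestrict (lpInftyPi μ) _ hmem,
    fun a => Subtype.ext (hA' a), Subtype.ext hS'⟩

theorem toeplitzX_qML (a : A) :
    toeplitzX A (ML L) (qML L a) = toeplitzA A (ML L) a * toeplitzX A (ML L) (qML L 1) :=
  Subtype.ext (lp.ext (funext fun i => i.rep.psi_qML a))

/-- Each coordinate `(ρ, V)` of `𝒯(A, α, L)` gives a Toeplitz representation of `M_L`, and the lifts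
are combined in the product. -/
theorem exists_toeplitz_to_exel : ∃ θ : ToeplitzAlgebra A (ML L) →⋆ₙₐ[ℂ] ExelToeplitzAlgebra L,
    (∀ a, θ (toeplitzA A (ML L) a) = exelA L a) ∧
      θ (toeplitzX A (ML L) (qML L 1)) = exelS L := by
  choose ν hA hX using fun j : ToeplitzCovRepInto L =>
    exists_toeplitzAlgebra_lift A (ML L) j.rep.toToeplitzRep
  have hA' : ∀ a, lpInftyPi ν (toeplitzA A (ML L) a) = exelProductA L a := fun a =>
    lp.ext (funext fun j => hA j a)
  have hS' : lpInftyPi ν (toeplitzX A (ML L) (qML L 1)) = exelProductS L :=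
    lp.ext (funext fun j => by
      refine (hX j (qML L 1)).trans ((j.rep.psi_qML 1).trans ?_)
      rw [map_one, one_mul]
      rfl)
  have hX' : ∀ a, lpInftyPi ν (toeplitzX A (ML L) (qML L a)) = exelProductA L a * exelProductS L :=
    fun a => by rw [toeplitzX_qML, map_mul, hA', hS']
  have hc : IsClosed {x | lpInftyPi ν x ∈ exelSubalgebra L} :=
    IsClosed.preimage (continuous_starAlgHom (lpInftyPi ν))
      (StarSubalgebra.isClosed_topologicalClosure _)
  have hmem : ∀ x, lpInftyPi ν x ∈ exelSubalgebra L := fun x =>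
    mem_of_isClosed_of_toeplitz
      (((exelSubalgebra L).toNonUnitalStarSubalgebra).comap (lpInftyPi ν)) hc
      (fun a => by
        change lpInftyPi ν (toeplitzA A (ML L) a) ∈ exelSubalgebra L
        rw [hA']
        exact (exelA L a).2)
      (fun x => by
        -- The generators `k_X(x)` run over the whole completion, but their images are known only
        -- for `x = q(a)`; continuity of `k_X` covers the rest.
        refine (denseRange_qML L).induction_on (p := fun x =>
          lpInftyPi ν (toeplitzX A (ML L) x) ∈ exelSubalgebra L) x
          (hc.preimage continuous_toeplitzX) fun a => ?_
        rw [hX']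
        exact (exelA L a * exelS L).2) x
  exact ⟨NonUnitalStarAlgHom.codRestrict (lpInftyPi ν)
    (exelSubalgebra L).toNonUnitalStarSubalgebra hmem,
    fun a => Subtype.ext (hA' a), Subtype.ext hS'⟩

theorem exists_exel_equiv_toeplitz : ∃ θ : ExelToeplitzAlgebra L ≃⋆ₐ[ℂ] ToeplitzAlgebra A (ML L),
    (∀ a, θ (exelA L a) = toeplitzA A (ML L) a) ∧
      ∀ a, θ (exelA L a * exelS L) = toeplitzX A (ML L) (qML L a) := by
  obtain ⟨θ, hA, hS⟩ := exists_exel_to_toeplitz L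
  obtain ⟨η, hA', hS'⟩ := exists_toeplitz_to_exel L
  have h1 : ∀ x, η (θ x) = x := fun x =>
    mem_of_isClosed_of_exel L
      (NonUnitalStarAlgHom.equalizer (η.comp θ) (NonUnitalStarAlgHom.id ℂ _))
      (isClosed_equalizer _ _)
      (fun a => by
        change η (θ (exelA L a)) = exelA L a
        rw [hA, hA'])
      (by
        change η (θ (exelS L)) = exelS L
        rw [hS, hS']) x
  have h2 : ∀ x, θ (η x) = x := fun x =>
    mem_of_isClosed_of_toeplitz
      (NonUnitalStarAlgHom.equalizer (θ.comp η) (NonUnitalStarAlgHom.id ℂ _))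
      (isClosed_equalizer _ _)
      (fun a => by
        change θ (η (toeplitzA A (ML L) a)) = toeplitzA A (ML L) a
        rw [hA', hA])
      (fun x => by
        refine (denseRange_qML L).induction_on (p := fun x =>
          θ (η (toeplitzX A (ML L) x)) = toeplitzX A (ML L) x) x
          (isClosed_eq (((continuous_starAlgHom θ).comp (continuous_starAlgHom η)).comp
            continuous_toeplitzX) continuous_toeplitzX) fun a => ?_
        -- Factoring `k_X(q(a)) = k_A(a) k_X(q(1))` reduces the claim to generators whose images are
        -- known.
        rw [toeplitzX_qML, map_mul, map_mul, hA', hS', hA, hS]) x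
  exact ⟨{ θ with
      invFun := η
      left_inv := h1
      right_inv := h2
      map_mul' := map_mul θ
      map_add' := map_add θ
      map_star' := map_star θ
      map_smul' := map_smul θ }, hA, fun a => by
    change θ (exelA L a * exelS L) = _
    rw [map_mul, hA, hS, ← toeplitzX_qML]⟩

end Isomorphism

end

theorem mainTheorem7 {A : Type u} [CStarAlgebra A] [PartialOrder A] [StarOrderedRing A]
    (α : A →⋆ₙₐ[ℂ] A) (L : TransferOperator α) :
    (∀ (B : Type v) [CStarAlgebra B],
      (∀ W : ToeplitzCovRep L B, ∃! R : ToeplitzRep A (ML L) B,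
        (∀ a, R.pi a = W.rho a) ∧ ∀ a, R.psi (qML L a) = W.rho a * W.V) ∧
      (∀ R : ToeplitzRep A (ML L) B, R.pi 1 = 1 → ∃! W : ToeplitzCovRep L B,
        (∀ a, W.rho a = R.pi a) ∧ W.V = R.psi (qML L 1) ∧
          ∀ a, R.psi (qML L a) = W.rho a * W.V)) ∧
    ∃ θ : ExelToeplitzAlgebra L ≃⋆ₐ[ℂ] ToeplitzAlgebra A (ML L),
      (∀ a, θ (exelA L a) = toeplitzA A (ML L) a) ∧
      ∀ a, θ (exelA L a * exelS L) = toeplitzX A (ML L) (qML L a) := by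
  refine ⟨fun B _ => ⟨fun W => ?_, fun R hR => ?_⟩, exists_exel_equiv_toeplitz L⟩
  · refine ⟨W.toToeplitzRep, ⟨fun _ => rfl, W.psi_qML⟩, fun R hR => ?_⟩
    -- Uniqueness rests on the automatic continuity of `ψ`, which is only assumed linear.
    refine ToeplitzRep.ext' hR.1 fun x => ?_
    exact congrFun ((denseRange_qML L).equalizer R.continuous_psi W.psi.continuous
      (funext fun a => (hR.2 a).trans (W.psi_qML a).symm)) x
  · refine ⟨R.toToeplitzCovRep hR, ⟨fun _ => rfl, rfl, R.psi_qML⟩, fun W hW => ?_⟩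
    exact ToeplitzCovRep.ext' hW.1 hW.2.1
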